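/- Let $M:[0,\infty)\to[0,\infty)$ be an $N$-function, i.e. $M$ is convex, $M(0)=0$, $\lim_{r\to0^+}M(r)/r=0$ and $\lim_{r\to\infty}M(r)/r=\infty$. Assume that $M$ is differentiable, that it satisfies the $\Delta_2$-condition (there is $C_M>1$ with $M(2r)\le C_M M(r)$ for all $r>0$), and that $r\mapsto M(r)/r^2$ is non-decreasing on $(0,\infty)$. Let $n\ge1$ and let $\gamma_n$ be the (unnormalized) Gaussian measure $d\gamma_n(x)=e^{-|x|^2/2}\,dx$ on $\mathbb R^n$. For $u\in C_0^\infty(\mathbb R^n)$ (real-valued, smooth, compactly supported), let $|\nabla u|$ be the Euclidean norm of the gradient and $|\nabla^{(2)}u|=\big(\sum_{i,j=1}^n(\partial^2u/\partial x_i\partial x_j)^2\big)^{1/2}$ the Hilbert–Schmidt norm of the Hessian. Let $L^M(\gamma_n)$ be the space of measurable $f$ with $\int_{\mathbb R^n} M(|f|/K)\,d\gamma_n\le1$ for some $K>0$, with the Luxemburg norm $$\|f\|_{L^M(\gamma_n)}=\inf\Big\{K>0:\int_{\mathbb R^n}M\big(|f(x)|/K\big)\,d\gamma_n(x)\le1\Big\}.$$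 1. There exist positive constants $C_1,C_2$ such that for every $u\in C_0^\infty(\mathbb R^n)$ the functions $M(|\nabla u|)$, $M(|\nabla^{(2)}u|)$ and $M(|u|)$ are $\gamma_n$-integrable and $$\int_{\mathbb R^n}M(|\nabla u|)\,d\gamma_n\le C_1\int_{\mathbb R^n}M(|\nabla^{(2)}u|)\,d\gamma_n+C_2\int_{\mathbb R^n}M(|u|)\,d\gamma_n.$$ 2. There exist positive constants $\tilde C_1,\tilde C_2$ such that for every $u\in C_0^\infty(\mathbb R^n)$ the functions $|\nabla u|$, $|\nabla^{(2)}u|$ and $u$ belong to $L^M(\gamma_n)$ and $$\|\nabla u\|_{L^M(\gamma_n)}\le\tilde C_1\sqrt{\|\nabla^{(2)}u\|_{L^M(\gamma_n)}\,\|u\|_{L^M(\gamma_n)}}+\tilde C_2\,\|u\|_{L^M(\gamma_n)},$$ where $\|\nabla u\|_{L^M(\gamma_n)}$ and $\|\nabla^{(2)}u\|_{L^M(\gamma_n)}$ are the norms of $|\nabla u|$ and $|\nabla^{(2)}u|$. -/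

import Mathlib

open MeasureTheory Filter Topology
open scoped ContDiff

namespace GaussLK

/-- `M : [0,∞) → [0,∞)` is an `N`-function: convex, `M 0 = 0`, `M r / r → 0` as `r → 0⁺`
and `M r / r → ∞` as `r → ∞`. Only the values of `M` on `[0,∞)` matter. -/
structure IsNFunction (M : ℝ → ℝ) : Prop where
  nonneg : ∀ r, 0 ≤ r → 0 ≤ M r
  convexOn : ConvexOn ℝ (Set.Ici 0) M
  map_zero : M 0 = 0
  tendsto_zero : Tendsto (fun r => M r / r) (𝓝[>] 0) (𝓝 0)
  tendsto_top : Tendsto (fun r => M r / r) atTop atTop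

/-- The `Δ₂`-condition. -/
def DeltaTwo (M : ℝ → ℝ) : Prop :=
  ∃ C : ℝ, 1 < C ∧ ∀ r : ℝ, 0 < r → M (2 * r) ≤ C * M r

/-- Membership in the Orlicz space `L^M(μ)`. The integral is a lower Lebesgue integral, so that
it is `∞` rather than `0` when `M(|f|/K)` is not integrable. -/
def MemOrlicz {α : Type*} [MeasurableSpace α] (M : ℝ → ℝ) (μ : Measure α) (f : α → ℝ) : Prop :=
  AEMeasurable f μ ∧ ∃ K : ℝ, 0 < K ∧ ∫⁻ x, ENNReal.ofReal (M (|f x| / K)) ∂μ ≤ 1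

/-- The Luxemburg norm on `L^M(μ)` (meaningful for `f` with `MemOrlicz M μ f`). -/
noncomputable def luxemburgNorm {α : Type*} [MeasurableSpace α] (M : ℝ → ℝ) (μ : Measure α)
    (f : α → ℝ) : ℝ :=
  sInf {K : ℝ | 0 < K ∧ ∫⁻ x, ENNReal.ofReal (M (|f x| / K)) ∂μ ≤ 1}

/-- The (unnormalized) Gaussian measure `dγₙ(x) = exp (-|x|²/2) dx` on `ℝⁿ`. -/
noncomputable def gaussMeasure (n : ℕ) : Measure (EuclideanSpace ℝ (Fin n)) :=
  (volume : Measure (EuclideanSpace ℝ (Fin n))).withDensity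
    (fun x => ENNReal.ofReal (Real.exp (-‖x‖ ^ 2 / 2)))

/-- The Hessian matrix `[∂²u/∂xᵢ∂xⱼ]` of `u` at `x`. -/
noncomputable def hessian {n : ℕ} (u : EuclideanSpace ℝ (Fin n) → ℝ)
    (x : EuclideanSpace ℝ (Fin n)) : Matrix (Fin n) (Fin n) ℝ :=
  Matrix.of fun i j =>
    fderiv ℝ (fun y => fderiv ℝ u y (EuclideanSpace.single j 1)) x (EuclideanSpace.single i 1)

/-- The Hilbert-Schmidt norm of a square matrix. -/
noncomputable def hsNorm {n : ℕ} (A : Matrix (Fin n) (Fin n) ℝ) : ℝ :=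
  Real.sqrt (∑ i, ∑ j, A i j ^ 2)

end GaussLK

/-!
Write `Φ(r) = M(r)/r²`, `p = |∇u|`, `H = |∇⁽²⁾u|` and `γ` for the Gaussian measure. The function `Φ`
is monotone, so it extends continuously to `[0, ∞)`, the field `v ↦ Φ(|v|) v` is differentiable on
the whole space (`IsAdmissible.radialField_deriv`), and convexity together with the `Δ₂`-condition
bounds its derivative by a multiple of `Φ(|v|)`. Two Gaussian integrations by parts, of the
divergences of `u Φ(p) ∇u` and of `M(p) x`, give
* `∫ M(p) ≤ ∫ |x| |u| Φ(p) p + c ∫ |u| Φ(p) H` (`IsAdmissible.integral_gradient_le`),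
* `∫ |x|² M(p) ≤ n ∫ M(p) + c ∫ |x| Φ(p) p H` (`IsAdmissible.integral_sq_norm_mul_le`),

all integrals being with respect to `γ`. The unbounded weight `|x|` in the first inequality is thus
moved onto the gradient and controlled by the second one, through Young's inequality. Monotonicity
of `Φ` gives `Φ(p) s t ≤ M(p) + M(s) + M(t)`, which turns the mixed products into modulars. The
outcome, for all `a, b > 0`, is
`∫ M(p) ≤ c b (1 + a) (∫ M(p) + ∫ M(|u|/b) + ∫ M(H/a))`
(`IsAdmissible.integral_gradient_le_scaled`). For `a = 1` and small `b` this is the modular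
inequality. For the norm inequality it is applied to `u/K` with `K` a large multiple of
`√(ab) + b`, where `a` and `b` decrease to the Luxemburg norms of `H` and `u`
(`IsAdmissible.luxemburgNorm_gradient_le`).

Differentiability of `M` gives no continuity of `M'` directly; none is needed, since the
integration by parts formula only asks for differentiability and an integrable derivative.
-/

namespace GaussLK

/-- The standing hypotheses on the growth function `M`, with `C` the constant of the
`Δ₂`-condition. -/
structure IsAdmissible (M : ℝ → ℝ) (C : ℝ) : Prop where
  isNFunction : IsNFunction M
  differentiableOn : DifferentiableOn ℝ M (Set.Ici 0)
  one_lt : 1 < C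
  doubling : ∀ r : ℝ, 0 < r → M (2 * r) ≤ C * M r
  monotoneOn : MonotoneOn (fun r : ℝ => M r / r ^ 2) (Set.Ioi 0)

/-- The function `Φ(r) = M(r)/r²`, extended to `r ≤ 0` by the constant `inf_{r > 0} M(r)/r²`,
which is its limit at `0⁺`; the extension is continuous and monotone. -/
noncomputable def quadQuot (M : ℝ → ℝ) (r : ℝ) : ℝ :=
  if 0 < r then M r / r ^ 2 else sInf ((fun r => M r / r ^ 2) '' Set.Ioi 0)

/-! ### Growth functions with `M(r)/r²` non-decreasing -/

section Growth

variable {M : ℝ → ℝ} {C : ℝ}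

lemma quadQuot_of_pos {r : ℝ} (hr : 0 < r) : quadQuot M r = M r / r ^ 2 := if_pos hr

lemma IsAdmissible.nonneg_of_nonneg (h : IsAdmissible M C) {r : ℝ} (hr : 0 ≤ r) : 0 ≤ M r :=
  h.isNFunction.nonneg r hr

lemma IsAdmissible.mul_sq_quadQuot (h : IsAdmissible M C) {r : ℝ} (hr : 0 ≤ r) :
    quadQuot M r * r ^ 2 = M r := by
  rcases hr.eq_or_lt with rfl | hr
  · simp [h.isNFunction.map_zero]
  · rw [quadQuot_of_pos hr]; field_simp

lemma IsAdmissible.quadQuot_nonneg (h : IsAdmissible M C) (r : ℝ) : 0 ≤ quadQuot M r := by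
  unfold quadQuot
  split_ifs with hr
  · exact div_nonneg (h.nonneg_of_nonneg hr.le) (sq_nonneg r)
  · refine Real.sInf_nonneg ?_
    rintro _ ⟨s, hs, rfl⟩
    exact div_nonneg (h.nonneg_of_nonneg (le_of_lt hs)) (sq_nonneg s)

lemma IsAdmissible.bddBelow (h : IsAdmissible M C) :
    BddBelow ((fun r => M r / r ^ 2) '' Set.Ioi 0) := by
  refine ⟨0, ?_⟩
  rintro _ ⟨s, hs, rfl⟩
  exact div_nonneg (h.nonneg_of_nonneg (le_of_lt hs)) (sq_nonneg s)

lemma IsAdmissible.monotone_quadQuot (h : IsAdmissible M C) : Monotone (quadQuot M) := by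
  intro r s hrs
  unfold quadQuot
  split_ifs with hr hs hs
  · exact h.monotoneOn hr hs hrs
  · exact absurd (hr.trans_le hrs) hs
  · exact csInf_le h.bddBelow ⟨s, hs, rfl⟩
  · exact le_rfl

lemma IsAdmissible.hasDerivAt (h : IsAdmissible M C) {r : ℝ} (hr : 0 < r) :
    HasDerivAt M (deriv M r) r :=
  ((h.differentiableOn r hr.le).differentiableAt (Ici_mem_nhds hr)).hasDerivAt

/-- By convexity the tangent at `r` lies below the graph at `0` and at `2r`, so
`0 ≤ M(r) ≤ r M'(r) ≤ M(2r) - M(r)`. -/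
lemma IsAdmissible.deriv_bounds (h : IsAdmissible M C) {r : ℝ} (hr : 0 < r) :
    0 ≤ deriv M r ∧ r * deriv M r ≤ C * M r := by
  have hc := h.isNFunction.convexOn
  have h0 : (0 : ℝ) ∈ Set.Ici (0 : ℝ) := Set.self_mem_Ici
  have h1 : r ∈ Set.Ici (0 : ℝ) := hr.le
  have h2 : 2 * r ∈ Set.Ici (0 : ℝ) := by simpa using hr.le
  have a := hc.slope_le_of_hasDerivAt h0 h1 hr (h.hasDerivAt hr)
  have b := hc.le_slope_of_hasDerivAt h1 h2 (by linarith) (h.hasDerivAt hr)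
  rw [slope_def_field, h.isNFunction.map_zero, sub_zero, sub_zero] at a
  rw [slope_def_field, show 2 * r - r = r by ring, le_div_iff₀ hr] at b
  refine ⟨(div_nonneg (h.nonneg_of_nonneg hr.le) hr.le).trans a, ?_⟩
  nlinarith [h.doubling r hr, h.nonneg_of_nonneg hr.le]

lemma IsAdmissible.hasDerivAt_quadQuot (h : IsAdmissible M C) {r : ℝ} (hr : 0 < r) :
    HasDerivAt (quadQuot M) ((deriv M r * r ^ 2 - M r * (2 * r)) / (r ^ 2) ^ 2) r := by
  have := (h.hasDerivAt hr).div (hasDerivAt_pow 2 r) (by positivity)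
  refine (this.congr_deriv (by norm_num)).congr_of_eventuallyEq ?_
  filter_upwards [Ioi_mem_nhds hr] with s hs
  exact quadQuot_of_pos hs

lemma IsAdmissible.continuous_quadQuot (h : IsAdmissible M C) : Continuous (quadQuot M) := by
  rw [continuous_iff_continuousAt]
  intro r
  rcases lt_trichotomy r 0 with hr | rfl | hr
  · refine (continuousAt_const (y := quadQuot M 0)).congr ?_
    filter_upwards [Iio_mem_nhds hr] with s hs
    simp [quadQuot, not_lt.2 (le_of_lt (Set.mem_Iio.1 hs))]
  · rw [continuousAt_iff_continuous_left'_right']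
    constructor
    · refine (continuousWithinAt_const (b := quadQuot M 0)).congr (fun s hs => ?_) rfl
      simp [quadQuot, not_lt.2 (le_of_lt (Set.mem_Iio.1 hs))]
    · have := h.monotone_quadQuot.tendsto_nhdsGT 0
      have e : quadQuot M '' Set.Ioi 0 = (fun r => M r / r ^ 2) '' Set.Ioi 0 :=
        Set.image_congr fun s hs => quadQuot_of_pos hs
      rw [e] at this
      simpa [ContinuousWithinAt, quadQuot] using this
  · exact (h.hasDerivAt_quadQuot hr).continuousAt

lemma IsAdmissible.continuous_comp (h : IsAdmissible M C) {α : Type*} [TopologicalSpace α]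
    {f : α → ℝ} (hf : Continuous f) (h0 : ∀ x, 0 ≤ f x) : Continuous fun x => M (f x) :=
  h.differentiableOn.continuousOn.comp_continuous hf h0

lemma IsAdmissible.mono (h : IsAdmissible M C) {r s : ℝ} (hr : 0 ≤ r) (hrs : r ≤ s) :
    M r ≤ M s := by
  rw [← h.mul_sq_quadQuot hr, ← h.mul_sq_quadQuot (hr.trans hrs)]
  exact mul_le_mul (h.monotone_quadQuot hrs) (pow_le_pow_left₀ hr hrs 2) (sq_nonneg r)
    (h.quadQuot_nonneg s)

/-- The product `Φ(p) s t` is at most `M` of the largest of the three arguments. -/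
lemma IsAdmissible.quadQuot_mul_mul_le (h : IsAdmissible M C) {p s t : ℝ} (hp : 0 ≤ p)
    (hs : 0 ≤ s) (ht : 0 ≤ t) : quadQuot M p * s * t ≤ M p + M s + M t := by
  have key : ∀ m, p ≤ m → s ≤ m → t ≤ m → quadQuot M p * s * t ≤ M m := by
    intro m h1 h2 h3
    have hm := hp.trans h1
    rw [← h.mul_sq_quadQuot hm, sq, ← mul_assoc]
    have := h.quadQuot_nonneg p
    have := h.quadQuot_nonneg m
    have := h.monotone_quadQuot h1
    gcongr
  have := h.nonneg_of_nonneg hp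
  have := h.nonneg_of_nonneg hs
  have := h.nonneg_of_nonneg ht
  rcases le_total p s with h1 | h1 <;> rcases le_total s t with h2 | h2 <;>
    rcases le_total p t with h3 | h3
  · linarith [key t h3 h2 le_rfl]
  · linarith [key t (h1.trans h2) h2 le_rfl]
  · linarith [key s h1 le_rfl h2]
  · linarith [key s h1 le_rfl h2]
  · linarith [key t h3 h2 le_rfl]
  · linarith [key p le_rfl h1 h3]
  · linarith [key t h3 (h1.trans h3) le_rfl]
  · linarith [key p le_rfl h1 h3]

/-- Iterating the `Δ₂`-condition: dilating the argument costs only a constant factor. -/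
lemma IsAdmissible.exists_dilation (h : IsAdmissible M C) {k : ℝ} (hk : 0 ≤ k) :
    ∃ D : ℝ, 0 < D ∧ ∀ r, 0 ≤ r → M (k * r) ≤ D * M r := by
  obtain ⟨m, hm⟩ := pow_unbounded_of_one_lt k (one_lt_two : (1 : ℝ) < 2)
  have hC : 0 < C := one_pos.trans h.one_lt
  have hpow : ∀ (m : ℕ) (r : ℝ), 0 < r → M (2 ^ m * r) ≤ C ^ m * M r := by
    intro m
    induction m with
    | zero => intro r _; simp
    | succ m ih =>
      intro r hr
      calc M (2 ^ (m + 1) * r) = M (2 * (2 ^ m * r)) := by ring_nf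
        _ ≤ C * M (2 ^ m * r) := h.doubling _ (by positivity)
        _ ≤ C * (C ^ m * M r) := by gcongr; exact ih r hr
        _ = C ^ (m + 1) * M r := by ring
  refine ⟨C ^ m, by positivity, fun r hr => ?_⟩
  rcases hr.eq_or_lt with rfl | hr
  · simp [h.isNFunction.map_zero]
  · exact (h.mono (by positivity) (by gcongr)).trans (hpow m r hr)

end Growth

/-! ### The radial field `v ↦ Φ(|v|) v` -/

section Field

variable {M : ℝ → ℝ} {C : ℝ} {V : Type*} [NormedAddCommGroup V] [InnerProductSpace ℝ V]

/-- The vector field `v ↦ Φ(|v|) v`, whose inner product with `v` is `M(|v|)`. -/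
noncomputable def radialField (M : ℝ → ℝ) (v : V) : V := quadQuot M ‖v‖ • v

lemma IsAdmissible.continuous_radialField (h : IsAdmissible M C) :
    Continuous (radialField M : V → V) :=
  (h.continuous_quadQuot.comp continuous_norm).smul continuous_id

/-- The field `v ↦ Φ(|v|) v` is differentiable everywhere, also at the origin, where its
derivative is `Φ(0)` times the identity. -/
lemma IsAdmissible.radialField_deriv (h : IsAdmissible M C) (v : V) :
    DifferentiableAt ℝ (radialField M) v ∧
      ∀ k, ‖fderiv ℝ (radialField M) v k‖ ≤ (C + 3) * quadQuot M ‖v‖ * ‖k‖ := by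
  have hC := h.one_lt
  have hΦ := h.quadQuot_nonneg ‖v‖
  by_cases hv : v = 0
  · subst hv
    have hd : HasFDerivAt (radialField M) (quadQuot M 0 • ContinuousLinearMap.id ℝ V) (0 : V) := by
      rw [hasFDerivAt_iff_isLittleO_nhds_zero]
      have h1 : (fun k : V => quadQuot M ‖k‖ - quadQuot M 0) =o[𝓝 0] fun _ : V => (1 : ℝ) := by
        rw [Asymptotics.isLittleO_one_iff]
        have := (h.continuous_quadQuot.comp (continuous_norm (E := V))).tendsto 0
        simp only [Function.comp_apply, norm_zero] at this
        simpa using this.sub_const (quadQuot M 0)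
      refine (h1.smul_isBigO (Asymptotics.isBigO_refl (fun k : V => k) _)).congr ?_ ?_
      · intro k; simp [radialField, sub_smul]
      · intro k; simp
    refine ⟨hd.differentiableAt, fun k => ?_⟩
    rw [hd.fderiv]
    simp only [norm_zero] at hΦ ⊢
    simp only [smul_apply, ContinuousLinearMap.id_apply, norm_smul,
      Real.norm_eq_abs, abs_of_nonneg hΦ]
    gcongr
    nlinarith
  · have hp : 0 < ‖v‖ := norm_pos_iff.2 hv
    have hn : DifferentiableAt ℝ (fun w : V => ‖w‖) v := differentiableAt_id.norm ℝ hv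
    have hL : ‖fderiv ℝ (fun w : V => ‖w‖) v‖ ≤ 1 := by
      simpa using norm_fderiv_le_of_lipschitz ℝ (lipschitzWith_one_norm (E := V)) (x₀ := v)
    have hd := ((h.hasDerivAt_quadQuot hp).comp_hasFDerivAt v hn.hasFDerivAt).smul
      (hasFDerivAt_id v)
    have hd' : HasFDerivAt (radialField M) _ v := hd
    refine ⟨hd'.differentiableAt, fun k => ?_⟩
    rw [hd'.fderiv]
    obtain ⟨b1, b2⟩ := h.deriv_bounds hp
    set r := ‖v‖ with hr
    have hM := h.mul_sq_quadQuot hp.le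
    set q := (deriv M r * r ^ 2 - M r * (2 * r)) / (r ^ 2) ^ 2 with hq
    have hqb : |q| * r ≤ (C + 2) * quadQuot M r := by
      have hM0 := h.nonneg_of_nonneg hp.le
      have e : q * r = (r * deriv M r - 2 * M r) / r ^ 2 := by rw [hq]; field_simp
      rw [← abs_of_pos hp, ← abs_mul, abs_of_pos hp, e, quadQuot_of_pos hp, abs_div,
        abs_of_pos (pow_pos hp 2), ← mul_div_assoc]
      gcongr
      rw [abs_le]
      constructor <;> nlinarith [mul_nonneg hp.le b1]
    have hLk : ‖fderiv ℝ (fun w : V => ‖w‖) v k‖ ≤ ‖k‖ := by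
      simpa using ContinuousLinearMap.le_of_opNorm_le _ hL k
    simp only [add_apply, smul_apply,
      ContinuousLinearMap.smulRight_apply, ContinuousLinearMap.id_apply, Function.comp_apply, id]
    refine (norm_add_le _ _).trans ?_
    simp only [norm_smul, norm_mul, smul_eq_mul, ← hr, Real.norm_eq_abs, abs_of_nonneg hΦ]
    rw [Real.norm_eq_abs] at hLk
    calc _ ≤ quadQuot M r * ‖k‖ + |q| * ‖k‖ * r := by gcongr
      _ = quadQuot M r * ‖k‖ + |q| * r * ‖k‖ := by ring
      _ ≤ quadQuot M r * ‖k‖ + (C + 2) * quadQuot M r * ‖k‖ := by gcongr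
      _ = _ := by ring

/-- Since `M(|v|)` is the inner product of `Φ(|v|) v` with `v`, its derivative is controlled by
that of the field. -/
lemma IsAdmissible.comp_norm_deriv (h : IsAdmissible M C) (v : V) :
    DifferentiableAt ℝ (fun w : V => M ‖w‖) v ∧
      ∀ k, |fderiv ℝ (fun w : V => M ‖w‖) v k| ≤ (C + 4) * quadQuot M ‖v‖ * ‖v‖ * ‖k‖ := by
  have e : (fun w : V => M ‖w‖) = fun w => inner ℝ (radialField M w) w := by
    funext w
    rw [radialField, real_inner_smul_left, real_inner_self_eq_norm_sq,
      h.mul_sq_quadQuot (norm_nonneg w)]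
  obtain ⟨hd, hb⟩ := h.radialField_deriv v
  rw [e]
  refine ⟨hd.inner ℝ differentiableAt_id, fun k => ?_⟩
  rw [fderiv_inner_apply ℝ hd differentiableAt_fun_id]
  have hΦ := h.quadQuot_nonneg ‖v‖
  have h1 := abs_real_inner_le_norm (radialField M v) k
  have h2 := abs_real_inner_le_norm (fderiv ℝ (radialField M) v k) v
  have h3 : ‖radialField M v‖ = quadQuot M ‖v‖ * ‖v‖ := by
    rw [radialField, norm_smul, Real.norm_eq_abs, abs_of_nonneg hΦ]
  rw [h3] at h1
  have h4 := mul_le_mul_of_nonneg_right (hb k) (norm_nonneg v)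
  simp only [fderiv_fun_id, ContinuousLinearMap.id_apply]
  refine (abs_add_le _ _).trans ?_
  nlinarith

end Field

/-! ### Integration by parts for the Gaussian measure -/

section Gauss

variable {n : ℕ}

lemma integrable_gaussWeight :
    Integrable fun x : EuclideanSpace ℝ (Fin n) => Real.exp (-‖x‖ ^ 2 / 2) := by
  have := (GaussianFourier.integrable_cexp_neg_mul_sq_norm_add
    (V := EuclideanSpace ℝ (Fin n)) (b := 1 / 2) (by norm_num) 0 0).norm
  refine this.congr (ae_of_all _ fun x => ?_)
  simp only [Complex.norm_exp]
  congr 1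
  norm_num [← Complex.ofReal_pow]
  ring

instance : IsFiniteMeasure (gaussMeasure n) :=
  isFiniteMeasure_withDensity_ofReal integrable_gaussWeight.2

lemma integral_gaussMeasure (f : EuclideanSpace ℝ (Fin n) → ℝ) :
    ∫ x, f x ∂gaussMeasure n = ∫ x, f x * Real.exp (-‖x‖ ^ 2 / 2) := by
  rw [gaussMeasure, integral_withDensity_eq_integral_toReal_smul (by fun_prop) (by simp)]
  refine integral_congr_ae (ae_of_all _ fun x => ?_)
  simp only [ENNReal.toReal_ofReal (Real.exp_pos _).le, smul_eq_mul, mul_comm]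

lemma integrable_gaussMeasure_iff (f : EuclideanSpace ℝ (Fin n) → ℝ) :
    Integrable f (gaussMeasure n) ↔
      Integrable fun x => f x * Real.exp (-‖x‖ ^ 2 / 2) := by
  rw [gaussMeasure, integrable_withDensity_iff_integrable_smul' (by fun_prop) (by simp)]
  refine integrable_congr (ae_of_all _ fun x => ?_)
  simp only [ENNReal.toReal_ofReal (Real.exp_pos _).le, smul_eq_mul, mul_comm]

/-- Gaussian integration by parts: `∫ ∂ₑg dγ = ∫ ⟨x, e⟩ g dγ`. The function `g` is only assumed
differentiable, with an integrable derivative that need not be continuous. -/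
lemma integral_fderiv_gaussMeasure {g : EuclideanSpace ℝ (Fin n) → ℝ} (hg : Differentiable ℝ g)
    (hgc : HasCompactSupport g) (e : EuclideanSpace ℝ (Fin n))
    (hi : Integrable (fun x => fderiv ℝ g x e) (gaussMeasure n)) :
    ∫ x, fderiv ℝ g x e ∂gaussMeasure n = ∫ x, inner ℝ x e * g x ∂gaussMeasure n := by
  have hw : ∀ x : EuclideanSpace ℝ (Fin n),
      HasFDerivAt (fun x : EuclideanSpace ℝ (Fin n) => Real.exp (-‖x‖ ^ 2 / 2))
        (Real.exp (-‖x‖ ^ 2 / 2) • -innerSL ℝ x) x := by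
    intro x
    have h1 := ((hasStrictFDerivAt_norm_sq x).hasFDerivAt.neg.mul_const (1 / 2 : ℝ)).exp
    refine (h1.congr_fderiv ?_).congr_of_eventuallyEq (Eventually.of_forall fun y => ?_)
    · ext k; simp; ring_nf; simp
    · simp; ring_nf
  have hwc : ∀ x : EuclideanSpace ℝ (Fin n),
      fderiv ℝ (fun x : EuclideanSpace ℝ (Fin n) => Real.exp (-‖x‖ ^ 2 / 2)) x e =
        -(Real.exp (-‖x‖ ^ 2 / 2) * inner ℝ x e) := by
    intro x; rw [(hw x).fderiv]; simp
  have hgcont := hg.continuous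
  have ig : Integrable (fun x => g x * Real.exp (-‖x‖ ^ 2 / 2)) :=
    (Continuous.integrable_of_hasCompactSupport (by fun_prop) hgc.mul_right)
  have igw : Integrable (fun x => g x * -(Real.exp (-‖x‖ ^ 2 / 2) * inner ℝ x e)) :=
    (Continuous.integrable_of_hasCompactSupport (by fun_prop) hgc.mul_right)
  have key := integral_mul_fderiv_eq_neg_fderiv_mul_of_integrable (μ := volume)
    (f := g) (g := fun x => Real.exp (-‖x‖ ^ 2 / 2)) (v := e)
    ((integrable_gaussMeasure_iff _).1 hi) (by simpa only [hwc] using igw) ig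
    (fun x _ => hg x) (fun x _ => (hw x).differentiableAt)
  rw [integral_gaussMeasure, integral_gaussMeasure, eq_comm, ← neg_inj, ← key, ← integral_neg]
  refine integral_congr_ae (ae_of_all _ fun x => ?_)
  simp only [hwc]
  ring

end Gauss

/-! ### Gradient and Hessian -/

section Hessian

variable {n : ℕ}

lemma gradient_apply (u : EuclideanSpace ℝ (Fin n) → ℝ) (x : EuclideanSpace ℝ (Fin n))
    (i : Fin n) : gradient u x i = fderiv ℝ u x (EuclideanSpace.single i 1) := by
  rw [← inner_gradient_left, EuclideanSpace.inner_single_right]; simp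

lemma contDiff_gradient {u : EuclideanSpace ℝ (Fin n) → ℝ} (hu : ContDiff ℝ ∞ u) :
    ContDiff ℝ ∞ (gradient u) :=
  (InnerProductSpace.toDual ℝ (EuclideanSpace ℝ (Fin n))).symm.toContinuousLinearEquiv.contDiff.comp
    (hu.fderiv_right (m := ∞) (by simp))

lemma hasCompactSupport_gradient {u : EuclideanSpace ℝ (Fin n) → ℝ} (hc : HasCompactSupport u) :
    HasCompactSupport (gradient u) :=
  (hc.fderiv ℝ).comp_left (map_zero _)

lemma hessian_apply {u : EuclideanSpace ℝ (Fin n) → ℝ} (hu : ContDiff ℝ ∞ u)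
    (x : EuclideanSpace ℝ (Fin n)) (i j : Fin n) :
    hessian u x i j = fderiv ℝ (gradient u) x (EuclideanSpace.single i 1) j := by
  have hd := (contDiff_gradient hu).differentiable (by simp) x
  have : (fun y => fderiv ℝ u y (EuclideanSpace.single j 1)) =
      (EuclideanSpace.proj j : EuclideanSpace ℝ (Fin n) →L[ℝ] ℝ) ∘ gradient u := by
    funext y; simp [gradient_apply]
  rw [hessian, Matrix.of_apply, this, fderiv_comp x (by fun_prop) hd,
    ContinuousLinearMap.fderiv]
  rfl

lemma norm_fderiv_gradient_le {u : EuclideanSpace ℝ (Fin n) → ℝ} (hu : ContDiff ℝ ∞ u)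
    (x : EuclideanSpace ℝ (Fin n)) (i : Fin n) :
    ‖fderiv ℝ (gradient u) x (EuclideanSpace.single i 1)‖ ≤ hsNorm (hessian u x) := by
  rw [EuclideanSpace.norm_eq, hsNorm]
  refine Real.sqrt_le_sqrt ?_
  simp only [hessian_apply hu, Real.norm_eq_abs, sq_abs]
  exact Finset.single_le_sum (f := fun i => ∑ j,
    (fderiv ℝ (gradient u) x (EuclideanSpace.single i 1) j) ^ 2)
    (fun i _ => Finset.sum_nonneg fun j _ => sq_nonneg _) (Finset.mem_univ i)

lemma hsNorm_nonneg (A : Matrix (Fin n) (Fin n) ℝ) : 0 ≤ hsNorm A := Real.sqrt_nonneg _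

lemma continuous_hsNorm_hessian {u : EuclideanSpace ℝ (Fin n) → ℝ} (hu : ContDiff ℝ ∞ u) :
    Continuous fun x => hsNorm (hessian u x) := by
  have := (contDiff_gradient hu).continuous_fderiv (by simp)
  simp only [hsNorm, hessian_apply hu]
  fun_prop

lemma hasCompactSupport_hsNorm_hessian {u : EuclideanSpace ℝ (Fin n) → ℝ}
    (hu : ContDiff ℝ ∞ u) (hc : HasCompactSupport u) :
    HasCompactSupport fun x => hsNorm (hessian u x) := by
  refine ((hasCompactSupport_gradient hc).fderiv ℝ).mono fun x hx => ?_
  contrapose! hx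
  simp only [Function.mem_support, not_not] at hx
  simp [hsNorm, hessian_apply hu, hx]

lemma gradient_const_smul (c : ℝ) {u : EuclideanSpace ℝ (Fin n) → ℝ} (hu : ContDiff ℝ ∞ u)
    (x : EuclideanSpace ℝ (Fin n)) : gradient (c • u) x = c • gradient u x := by
  rw [gradient, fderiv_const_smul (hu.differentiable (by simp) x), gradient]
  simp

lemma hessian_const_smul (c : ℝ) {u : EuclideanSpace ℝ (Fin n) → ℝ} (hu : ContDiff ℝ ∞ u)
    (x : EuclideanSpace ℝ (Fin n)) : hessian (c • u) x = c • hessian u x := by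
  ext i j
  have hcu : ContDiff ℝ ∞ (c • u) := hu.const_smul c
  have e : gradient (c • u) = c • gradient u := funext (gradient_const_smul c hu)
  rw [hessian_apply hcu, Matrix.smul_apply, hessian_apply hu, e,
    fderiv_const_smul ((contDiff_gradient hu).differentiable (by simp) x)]
  simp

lemma hsNorm_smul (c : ℝ) (A : Matrix (Fin n) (Fin n) ℝ) : hsNorm (c • A) = |c| * hsNorm A := by
  simp only [hsNorm, Matrix.smul_apply, smul_eq_mul, mul_pow, ← Finset.mul_sum]
  rw [Real.sqrt_mul (sq_nonneg c), Real.sqrt_sq_eq_abs]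

end Hessian

/-! ### The interpolation inequality with parameters -/

section Key

variable {n : ℕ} {M : ℝ → ℝ} {C : ℝ} {u : EuclideanSpace ℝ (Fin n) → ℝ}

lemma abs_apply_le_norm (x : EuclideanSpace ℝ (Fin n)) (i : Fin n) : |x i| ≤ ‖x‖ := by
  simpa using PiLp.norm_apply_le x i

lemma IsAdmissible.integrable_comp_abs (h : IsAdmissible M C)
    {f : EuclideanSpace ℝ (Fin n) → ℝ} (hf : Continuous f) (hc : HasCompactSupport f) :
    Integrable (fun x => M |f x|) (gaussMeasure n) :=
  (h.continuous_comp hf.abs fun _ => abs_nonneg _).integrable_of_hasCompactSupport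
    (hc.comp_left (g := fun r => M |r|) (by simp [h.isNFunction.map_zero]))

lemma IsAdmissible.integrable_comp_norm_gradient (h : IsAdmissible M C) (hu : ContDiff ℝ ∞ u)
    (hc : HasCompactSupport u) : Integrable (fun x => M ‖gradient u x‖) (gaussMeasure n) := by
  simpa using h.integrable_comp_abs (contDiff_gradient hu).continuous.norm
    (hasCompactSupport_gradient hc).norm

lemma IsAdmissible.integrable_comp_hsNorm_hessian (h : IsAdmissible M C) (hu : ContDiff ℝ ∞ u)
    (hc : HasCompactSupport u) :
    Integrable (fun x => M (hsNorm (hessian u x))) (gaussMeasure n) := by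
  simpa only [abs_of_nonneg (hsNorm_nonneg _)] using
    h.integrable_comp_abs (continuous_hsNorm_hessian hu) (hasCompactSupport_hsNorm_hessian hu hc)

/-- A differentiable compactly supported function whose derivative in the direction `e` is
dominated by a continuous compactly supported function satisfies the integration by parts formula,
and its derivative is integrable. -/
lemma integral_fderiv_of_le {g B : EuclideanSpace ℝ (Fin n) → ℝ} (hg : Differentiable ℝ g)
    (hgc : HasCompactSupport g) (e : EuclideanSpace ℝ (Fin n)) (hB : Continuous B)
    (hBc : HasCompactSupport B) (hle : ∀ x, |fderiv ℝ g x e| ≤ B x) :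
    Integrable (fun x => fderiv ℝ g x e) (gaussMeasure n) ∧
      ∫ x, fderiv ℝ g x e ∂gaussMeasure n = ∫ x, inner ℝ x e * g x ∂gaussMeasure n := by
  have hi : Integrable (fun x => fderiv ℝ g x e) (gaussMeasure n) :=
    (hB.integrable_of_hasCompactSupport hBc).mono'
      (measurable_fderiv_apply_const ℝ g e).aestronglyMeasurable (ae_of_all _ hle)
  exact ⟨hi, integral_fderiv_gaussMeasure hg hgc e hi⟩

/-- Integration by parts of the divergence of `u Φ(|∇u|) ∇u`. -/
lemma IsAdmissible.integral_gradient_le (h : IsAdmissible M C) (hu : ContDiff ℝ ∞ u)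
    (hc : HasCompactSupport u) :
    ∫ x, M ‖gradient u x‖ ∂gaussMeasure n ≤
      ∫ x, ‖x‖ * |u x| * quadQuot M ‖gradient u x‖ * ‖gradient u x‖ ∂gaussMeasure n +
      n * (C + 4) * ∫ x, |u x| * quadQuot M ‖gradient u x‖ * hsNorm (hessian u x)
        ∂gaussMeasure n := by
  have hC := h.one_lt
  have hv := contDiff_gradient hu
  have hvc := hv.continuous
  have hvd : Differentiable ℝ (gradient u) := hv.differentiable (by simp)
  have hud : Differentiable ℝ u := hu.differentiable (by simp)
  have huc := hu.continuous
  have hHc := continuous_hsNorm_hessian hu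
  have hΦc : Continuous fun x => quadQuot M ‖gradient u x‖ :=
    h.continuous_quadQuot.comp hvc.norm
  have hΦ := fun x => h.quadQuot_nonneg ‖gradient u x‖
  have hFd : Differentiable ℝ fun x => radialField M (gradient u x) := fun x =>
    (h.radialField_deriv _).1.comp x (hvd x)
  set g : Fin n → EuclideanSpace ℝ (Fin n) → ℝ :=
    fun i x => u x * radialField M (gradient u x) i with hg
  have hgd : ∀ i, Differentiable ℝ (g i) := fun i => by
    have : Differentiable ℝ fun x => radialField M (gradient u x) i :=
      (EuclideanSpace.proj i : EuclideanSpace ℝ (Fin n) →L[ℝ] ℝ).differentiable.comp hFd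
    exact hud.mul this
  have hgs : ∀ i, HasCompactSupport (g i) := fun i => hc.mul_right
  have hder : ∀ i x, |fderiv ℝ (g i) x (EuclideanSpace.single i 1) -
      gradient u x i * radialField M (gradient u x) i| ≤
      (C + 4) * (|u x| * quadQuot M ‖gradient u x‖ * hsNorm (hessian u x)) := by
    intro i x
    have h1 : HasFDerivAt (fun x => radialField M (gradient u x) i) _ x :=
      (EuclideanSpace.proj i : EuclideanSpace ℝ (Fin n) →L[ℝ] ℝ).hasFDerivAt.comp x
        ((h.radialField_deriv _).1.hasFDerivAt.comp x (hvd x).hasFDerivAt)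
    have h2 : HasFDerivAt (g i) _ x := (hud x).hasFDerivAt.mul h1
    rw [h2.fderiv]
    set k := fderiv ℝ (gradient u) x (EuclideanSpace.single i 1) with hk
    have h3 : |fderiv ℝ (radialField M) (gradient u x) k i| ≤
        (C + 3) * quadQuot M ‖gradient u x‖ * hsNorm (hessian u x) :=
      (abs_apply_le_norm _ i).trans <| ((h.radialField_deriv _).2 k).trans <| by
        have := norm_fderiv_gradient_le hu x i
        have := hΦ x
        gcongr
    simp only [add_apply, smul_apply, ContinuousLinearMap.comp_apply, smul_eq_mul,
      ← gradient_apply, ← hk, PiLp.proj_apply]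
    rw [mul_comm (radialField M (gradient u x) i), add_sub_cancel_right, abs_mul]
    calc _ ≤ |u x| * ((C + 3) * quadQuot M ‖gradient u x‖ * hsNorm (hessian u x)) := by gcongr
      _ ≤ |u x| * ((C + 4) * quadQuot M ‖gradient u x‖ * hsNorm (hessian u x)) := by
        have := hΦ x
        have := hsNorm_nonneg (hessian u x)
        gcongr
        norm_num
      _ = _ := by ring
  have hFc : Continuous fun x => radialField M (gradient u x) := hFd.continuous
  have hFs : ∀ i, HasCompactSupport fun x => gradient u x i * radialField M (gradient u x) i := by
    intro i
    exact (hasCompactSupport_gradient hc).comp_left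
      (g := fun v : EuclideanSpace ℝ (Fin n) => v i * radialField M v i) (by simp)
  have hRc : Continuous fun x => |u x| * quadQuot M ‖gradient u x‖ * hsNorm (hessian u x) := by
    fun_prop
  have hRs : HasCompactSupport
      fun x => |u x| * quadQuot M ‖gradient u x‖ * hsNorm (hessian u x) :=
    (hc.comp_left abs_zero).mul_right.mul_right
  have hRi := hRc.integrable_of_hasCompactSupport (μ := gaussMeasure n) hRs
  have ibp := fun i => integral_fderiv_of_le (hgd i) (hgs i) (EuclideanSpace.single i 1)
    (B := fun x => |gradient u x i * radialField M (gradient u x) i| +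
      (C + 4) * (|u x| * quadQuot M ‖gradient u x‖ * hsNorm (hessian u x))) (by fun_prop)
    (((hFs i).comp_left abs_zero).add hRs.mul_left) (fun x => by
      have := hder i x
      have := abs_add_le (fderiv ℝ (g i) x (EuclideanSpace.single i 1) -
        gradient u x i * radialField M (gradient u x) i)
        (gradient u x i * radialField M (gradient u x) i)
      rw [sub_add_cancel] at this
      linarith)
  have hinner : ∀ v : EuclideanSpace ℝ (Fin n),
      ∑ i, v i * radialField M v i = M ‖v‖ := by
    intro v
    rw [← h.mul_sq_quadQuot (norm_nonneg v), EuclideanSpace.real_norm_sq_eq, Finset.mul_sum]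
    exact Finset.sum_congr rfl fun i _ => by simp [radialField]; ring
  have hgc : ∀ i, Continuous (g i) := fun i => (hgd i).continuous
  have hxi : ∀ i, Integrable (fun x => x i * g i x) (gaussMeasure n) := fun i =>
    Continuous.integrable_of_hasCompactSupport (by fun_prop) (hgs i).mul_left
  calc ∫ x, M ‖gradient u x‖ ∂gaussMeasure n
      ≤ ∫ x, (∑ i, fderiv ℝ (g i) x (EuclideanSpace.single i 1)) +
          n * (C + 4) * (|u x| * quadQuot M ‖gradient u x‖ * hsNorm (hessian u x))
          ∂gaussMeasure n := by
        refine integral_mono (h.integrable_comp_norm_gradient hu hc)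
          ((integrable_finsetSum _ fun i _ => (ibp i).1).add (hRi.const_mul _)) fun x => ?_
        have := Finset.sum_le_sum fun i (_ : i ∈ Finset.univ) => neg_le_of_abs_le (hder i x)
        rw [Finset.sum_sub_distrib, hinner] at this
        simp only [Finset.sum_neg_distrib, Finset.sum_const, Finset.card_univ, Fintype.card_fin,
          nsmul_eq_mul] at this
        dsimp only
        linarith
    _ = (∫ x, ∑ i, x i * g i x ∂gaussMeasure n) + n * (C + 4) *
          ∫ x, |u x| * quadQuot M ‖gradient u x‖ * hsNorm (hessian u x) ∂gaussMeasure n := by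
        rw [integral_add (integrable_finsetSum _ fun i _ => (ibp i).1) (hRi.const_mul _),
          integral_finsetSum _ fun i _ => (ibp i).1, integral_finsetSum _ fun i _ => hxi i,
          integral_const_mul]
        congr 1
        refine Finset.sum_congr rfl fun i _ => ?_
        rw [(ibp i).2]
        simp [EuclideanSpace.inner_single_right]
    _ ≤ _ := by
        have hLi : Integrable (fun x => ‖x‖ * |u x| * quadQuot M ‖gradient u x‖ * ‖gradient u x‖)
            (gaussMeasure n) :=
          Continuous.integrable_of_hasCompactSupport (by fun_prop)
            ((hc.comp_left abs_zero).mul_left (f := fun x => ‖x‖)).mul_right.mul_right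
        refine add_le_add (integral_mono (integrable_finsetSum _ fun i _ => hxi i) hLi
          fun x => ?_) le_rfl
        have e : ∑ i, x i * g i x =
            u x * (quadQuot M ‖gradient u x‖ * inner ℝ x (gradient u x)) := by
          simp only [hg, radialField, PiLp.inner_apply, Finset.mul_sum]
          exact Finset.sum_congr rfl fun i _ => by simp; ring
        dsimp only
        rw [e]
        refine (le_abs_self _).trans ?_
        rw [abs_mul, abs_mul, abs_of_nonneg (hΦ x)]
        calc _ ≤ |u x| * (quadQuot M ‖gradient u x‖ * (‖x‖ * ‖gradient u x‖)) := by
              have := hΦ x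
              gcongr
              exact abs_real_inner_le_norm _ _
          _ = _ := by ring

/-- Integration by parts of the divergence of `M(|∇u|) x`. -/
lemma IsAdmissible.integral_sq_norm_mul_le (h : IsAdmissible M C) (hu : ContDiff ℝ ∞ u)
    (hc : HasCompactSupport u) :
    ∫ x, ‖x‖ ^ 2 * M ‖gradient u x‖ ∂gaussMeasure n ≤
      n * ∫ x, M ‖gradient u x‖ ∂gaussMeasure n +
      n * (C + 4) * ∫ x, ‖x‖ * quadQuot M ‖gradient u x‖ * ‖gradient u x‖ *
        hsNorm (hessian u x) ∂gaussMeasure n := by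
  have hC := h.one_lt
  have hv := contDiff_gradient hu
  have hvc := hv.continuous
  have hvd : Differentiable ℝ (gradient u) := hv.differentiable (by simp)
  have hHc := continuous_hsNorm_hessian hu
  have hΦc : Continuous fun x => quadQuot M ‖gradient u x‖ :=
    h.continuous_quadQuot.comp hvc.norm
  have hΦ := fun x => h.quadQuot_nonneg ‖gradient u x‖
  have hNd : Differentiable ℝ fun x => M ‖gradient u x‖ := fun x =>
    (h.comp_norm_deriv _).1.comp x (hvd x)
  have hNc := hNd.continuous
  have hNs : HasCompactSupport fun x => M ‖gradient u x‖ :=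
    (hasCompactSupport_gradient hc).comp_left (g := fun v => M ‖v‖)
      (by simp [h.isNFunction.map_zero])
  have hNi := h.integrable_comp_norm_gradient hu hc
  set g : Fin n → EuclideanSpace ℝ (Fin n) → ℝ := fun i x => x i * M ‖gradient u x‖ with hg
  have hxd : ∀ i, Differentiable ℝ fun x : EuclideanSpace ℝ (Fin n) => x i := fun i =>
    (EuclideanSpace.proj i : EuclideanSpace ℝ (Fin n) →L[ℝ] ℝ).differentiable
  have hgd : ∀ i, Differentiable ℝ (g i) := fun i => (hxd i).mul hNd
  have hgs : ∀ i, HasCompactSupport (g i) := fun i => hNs.mul_left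
  have hder : ∀ i x, |fderiv ℝ (g i) x (EuclideanSpace.single i 1) - M ‖gradient u x‖| ≤
      (C + 4) * (‖x‖ * quadQuot M ‖gradient u x‖ * ‖gradient u x‖ * hsNorm (hessian u x)) := by
    intro i x
    have h0 : HasFDerivAt (fun x : EuclideanSpace ℝ (Fin n) => x i) _ x :=
      (EuclideanSpace.proj i : EuclideanSpace ℝ (Fin n) →L[ℝ] ℝ).hasFDerivAt
    have h1 : HasFDerivAt (fun x => M ‖gradient u x‖) _ x :=
      (h.comp_norm_deriv _).1.hasFDerivAt.comp x (hvd x).hasFDerivAt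
    have h2 : HasFDerivAt (g i) _ x := h0.mul h1
    rw [h2.fderiv]
    set k := fderiv ℝ (gradient u) x (EuclideanSpace.single i 1) with hk
    have h3 : |fderiv ℝ (fun w => M ‖w‖) (gradient u x) k| ≤
        (C + 4) * quadQuot M ‖gradient u x‖ * ‖gradient u x‖ * hsNorm (hessian u x) :=
      ((h.comp_norm_deriv _).2 k).trans <| by
        have := norm_fderiv_gradient_le hu x i
        have := hΦ x
        gcongr
    simp only [add_apply, smul_apply, ContinuousLinearMap.comp_apply, smul_eq_mul,
      ← hk, PiLp.proj_apply, PiLp.single_apply, if_true, mul_one]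
    rw [add_sub_cancel_right, abs_mul]
    calc _ ≤ ‖x‖ * ((C + 4) * quadQuot M ‖gradient u x‖ * ‖gradient u x‖ *
          hsNorm (hessian u x)) := by
          gcongr
          exact abs_apply_le_norm x i
      _ = _ := by ring
  have hRc : Continuous fun x => ‖x‖ * quadQuot M ‖gradient u x‖ * ‖gradient u x‖ *
      hsNorm (hessian u x) := by fun_prop
  have hRs : HasCompactSupport fun x => ‖x‖ * quadQuot M ‖gradient u x‖ * ‖gradient u x‖ *
      hsNorm (hessian u x) := (hasCompactSupport_hsNorm_hessian hu hc).mul_left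
  have hRi := hRc.integrable_of_hasCompactSupport (μ := gaussMeasure n) hRs
  have ibp := fun i => integral_fderiv_of_le (hgd i) (hgs i) (EuclideanSpace.single i 1)
    (B := fun x => |M ‖gradient u x‖| + (C + 4) *
      (‖x‖ * quadQuot M ‖gradient u x‖ * ‖gradient u x‖ * hsNorm (hessian u x)))
    (hNc.abs.add (continuous_const.mul hRc))
    ((hNs.comp_left abs_zero).add hRs.mul_left) (fun x => by
      have := hder i x
      have := abs_add_le (fderiv ℝ (g i) x (EuclideanSpace.single i 1) - M ‖gradient u x‖)
        (M ‖gradient u x‖)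
      rw [sub_add_cancel] at this
      linarith)
  have hgc : ∀ i, Continuous (g i) := fun i => (hgd i).continuous
  have hxi : ∀ i, Integrable (fun x => x i * g i x) (gaussMeasure n) := fun i =>
    Continuous.integrable_of_hasCompactSupport (by fun_prop) (hgs i).mul_left
  calc ∫ x, ‖x‖ ^ 2 * M ‖gradient u x‖ ∂gaussMeasure n
      = ∫ x, ∑ i, x i * g i x ∂gaussMeasure n := by
        refine integral_congr_ae (ae_of_all _ fun x => ?_)
        simp only [hg]
        rw [EuclideanSpace.real_norm_sq_eq, Finset.sum_mul]
        exact Finset.sum_congr rfl fun i _ => by ring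
    _ = ∫ x, ∑ i, fderiv ℝ (g i) x (EuclideanSpace.single i 1) ∂gaussMeasure n := by
        rw [integral_finsetSum _ fun i _ => (ibp i).1, integral_finsetSum _ fun i _ => hxi i]
        refine Finset.sum_congr rfl fun i _ => ?_
        rw [(ibp i).2]
        simp [EuclideanSpace.inner_single_right]
    _ ≤ ∫ x, n * M ‖gradient u x‖ + n * (C + 4) * (‖x‖ * quadQuot M ‖gradient u x‖ *
          ‖gradient u x‖ * hsNorm (hessian u x)) ∂gaussMeasure n := by
        refine integral_mono (integrable_finsetSum _ fun i _ => (ibp i).1)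
          ((hNi.const_mul _).add (hRi.const_mul _)) fun x => ?_
        have := Finset.sum_le_sum fun i (_ : i ∈ Finset.univ) => le_of_abs_le (hder i x)
        rw [Finset.sum_sub_distrib] at this
        simp only [Finset.sum_const, Finset.card_univ, Fintype.card_fin,
          nsmul_eq_mul] at this
        dsimp only
        linarith
    _ = _ := by
        rw [integral_add (hNi.const_mul _) (hRi.const_mul _), integral_const_mul,
          integral_const_mul]

/-- The parametrized form of the interpolation inequality. The parameters `a` and `b` measure the
size of the Hessian and of `u`; the prefactor is small when `b` is small, so that the term
`∫ M(|∇u|)` on the right can be absorbed. -/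
lemma IsAdmissible.integral_gradient_le_scaled (h : IsAdmissible M C) (hu : ContDiff ℝ ∞ u)
    (hc : HasCompactSupport u) {a b : ℝ} (ha : 0 < a) (hb : 0 < b) :
    ∫ x, M ‖gradient u x‖ ∂gaussMeasure n ≤
      (1 + n + n * (C + 4) + (n * (C + 4)) ^ 2) * (b * (1 + a)) *
      (∫ x, M ‖gradient u x‖ ∂gaussMeasure n + ∫ x, M (|u x| / b) ∂gaussMeasure n +
        ∫ x, M (hsNorm (hessian u x) / a) ∂gaussMeasure n) := by
  have hC := h.one_lt
  have hvc := (contDiff_gradient hu).continuous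
  have huc := hu.continuous
  have hHc := continuous_hsNorm_hessian hu
  have hΦc : Continuous fun x => quadQuot M ‖gradient u x‖ :=
    h.continuous_quadQuot.comp hvc.norm
  have hΦ := fun x => h.quadQuot_nonneg ‖gradient u x‖
  have hH := fun x => hsNorm_nonneg (hessian u x)
  have hua : HasCompactSupport fun x => |u x| := hc.comp_left abs_zero
  have hHs := hasCompactSupport_hsNorm_hessian hu hc
  have hMc : Continuous fun x => M ‖gradient u x‖ :=
    h.continuous_comp hvc.norm fun _ => norm_nonneg _
  have hMs : HasCompactSupport fun x => M ‖gradient u x‖ :=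
    (hasCompactSupport_gradient hc).comp_left (g := fun v => M ‖v‖)
      (by simp [h.isNFunction.map_zero])
  have iA := h.integrable_comp_norm_gradient hu hc
  have iU : Integrable (fun x => M (|u x| / b)) (gaussMeasure n) := by
    simpa [abs_div, abs_of_pos hb] using h.integrable_comp_abs (f := fun x => u x / b)
      (by fun_prop) (hc.comp_left (g := fun r => r / b) (by simp))
  have iH : Integrable (fun x => M (hsNorm (hessian u x) / a)) (gaussMeasure n) := by
    simpa [abs_div, abs_of_pos ha, abs_of_nonneg (hH _)] using
      h.integrable_comp_abs (f := fun x => hsNorm (hessian u x) / a)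
      (by fun_prop) (hHs.comp_left (g := fun r => r / a) (by simp))
  have iX : Integrable (fun x => ‖x‖ ^ 2 * M ‖gradient u x‖) (gaussMeasure n) :=
    Continuous.integrable_of_hasCompactSupport ((continuous_norm.pow 2).mul hMc) hMs.mul_left
  have iHH : Integrable (fun x => quadQuot M ‖gradient u x‖ * hsNorm (hessian u x) *
      hsNorm (hessian u x)) (gaussMeasure n) :=
    Continuous.integrable_of_hasCompactSupport (by fun_prop) hHs.mul_left
  have iAH : Integrable (fun x => M ‖gradient u x‖ + 2 * M (hsNorm (hessian u x) / a))
    (gaussMeasure n) := iA.add (iH.const_mul 2)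
  have iAU : Integrable (fun x => M ‖gradient u x‖ + M (|u x| / b)) (gaussMeasure n) := iA.add iU
  have iAUH : Integrable (fun x => M ‖gradient u x‖ + M (|u x| / b) +
    M (hsNorm (hessian u x) / a)) (gaussMeasure n) := iAU.add iH
  have iAUU : Integrable (fun x => M ‖gradient u x‖ + 2 * M (|u x| / b)) (gaussMeasure n) :=
    iA.add (iU.const_mul 2)
  have iAUX : Integrable (fun x => (1 + a) * (M ‖gradient u x‖ + 2 * M (|u x| / b)) +
    ‖x‖ ^ 2 * M ‖gradient u x‖ / (1 + a)) (gaussMeasure n) :=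
    (iAUU.const_mul _).add (iX.div_const _)
  set c := n * (C + 4) with hcdef
  have hc0 : 0 ≤ c := by positivity
  set A := ∫ x, M ‖gradient u x‖ ∂gaussMeasure n
  set U := ∫ x, M (|u x| / b) ∂gaussMeasure n
  set H := ∫ x, M (hsNorm (hessian u x) / a) ∂gaussMeasure n
  set X := ∫ x, ‖x‖ ^ 2 * M ‖gradient u x‖ ∂gaussMeasure n
  have hA0 : 0 ≤ A := integral_nonneg fun x => h.nonneg_of_nonneg (norm_nonneg _)
  have hU0 : 0 ≤ U := integral_nonneg fun x => h.nonneg_of_nonneg (by positivity)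
  have hH0 : 0 ≤ H := integral_nonneg fun x => h.nonneg_of_nonneg (div_nonneg (hH x) ha.le)
  have e1 : ∫ x, quadQuot M ‖gradient u x‖ * hsNorm (hessian u x) * hsNorm (hessian u x)
      ∂gaussMeasure n ≤ a ^ 2 * (A + 2 * H) := by
    rw [← integral_const_mul, ← integral_add iA (iH.const_mul 2), ← integral_const_mul]
    refine integral_mono iHH (iAH.const_mul _) fun x => ?_
    have := h.quadQuot_mul_mul_le (norm_nonneg (gradient u x)) (div_nonneg (hH x) ha.le)
      (div_nonneg (hH x) ha.le)
    calc _ = a ^ 2 * (quadQuot M ‖gradient u x‖ * (hsNorm (hessian u x) / a) *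
          (hsNorm (hessian u x) / a)) := by field_simp
      _ ≤ _ := by
        gcongr
        linarith
  have e2 : c * ∫ x, ‖x‖ * quadQuot M ‖gradient u x‖ * ‖gradient u x‖ * hsNorm (hessian u x)
      ∂gaussMeasure n ≤ X / 2 + c ^ 2 / 2 * (a ^ 2 * (A + 2 * H)) := by
    refine le_trans ?_ (add_le_add_right (mul_le_mul_of_nonneg_left e1 (by positivity)) _)
    rw [← integral_const_mul, ← integral_const_mul, ← integral_div,
      ← integral_add (iX.div_const 2) (iHH.const_mul _)]
    refine integral_mono (Continuous.integrable_of_hasCompactSupport (by fun_prop)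
      hHs.mul_left.mul_left) ((iX.div_const 2).add (iHH.const_mul _)) fun x => ?_
    dsimp only
    rw [← h.mul_sq_quadQuot (norm_nonneg (gradient u x))]
    nlinarith [mul_nonneg (hΦ x) (sq_nonneg (‖x‖ * ‖gradient u x‖ - c * hsNorm (hessian u x)))]
  have e3 := h.integral_sq_norm_mul_le hu hc
  have e4 : ∫ x, |u x| * quadQuot M ‖gradient u x‖ * hsNorm (hessian u x) ∂gaussMeasure n ≤
      a * b * (A + U + H) := by
    rw [← integral_add iA iU, ← integral_add iAU iH, ← integral_const_mul]
    refine integral_mono (Continuous.integrable_of_hasCompactSupport (by fun_prop)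
      hHs.mul_left) (iAUH.const_mul _) fun x => ?_
    have := h.quadQuot_mul_mul_le (norm_nonneg (gradient u x))
      (div_nonneg (abs_nonneg (u x)) hb.le) (div_nonneg (hH x) ha.le)
    calc _ = a * b * (quadQuot M ‖gradient u x‖ * (|u x| / b) *
          (hsNorm (hessian u x) / a)) := by field_simp
      _ ≤ _ := by
        gcongr
  -- Young's inequality with weight `1 + a`, the choice that balances the two resulting terms.
  have e5 : ∫ x, ‖x‖ * |u x| * quadQuot M ‖gradient u x‖ * ‖gradient u x‖ ∂gaussMeasure n ≤
      b / 2 * ((1 + a) * (A + 2 * U) + X / (1 + a)) := by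
    rw [← integral_const_mul, ← integral_add iA (iU.const_mul 2), ← integral_const_mul,
      ← integral_div, ← integral_add (iAUU.const_mul _) (iX.div_const _), ← integral_const_mul]
    refine integral_mono (Continuous.integrable_of_hasCompactSupport (by fun_prop)
      hua.mul_left.mul_right.mul_right)
      (iAUX.const_mul _) fun x => ?_
    have h1 := h.quadQuot_mul_mul_le (norm_nonneg (gradient u x))
      (div_nonneg (abs_nonneg (u x)) hb.le) (div_nonneg (abs_nonneg (u x)) hb.le)
    dsimp only
    have h2 : ‖x‖ * |u x| * quadQuot M ‖gradient u x‖ * ‖gradient u x‖ ≤ b / 2 * ((1 + a) *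
        (quadQuot M ‖gradient u x‖ * (|u x| / b) * (|u x| / b)) +
          ‖x‖ ^ 2 * M ‖gradient u x‖ / (1 + a)) := by
      rw [← h.mul_sq_quadQuot (norm_nonneg (gradient u x))]
      have hs : 0 < 1 + a := by positivity
      obtain ⟨t, ht⟩ : ∃ t, t = |u x| / b := ⟨_, rfl⟩
      have hut : |u x| = b * t := by rw [ht]; field_simp
      rw [← ht, hut]
      have h3 := mul_nonneg (mul_nonneg hb.le (hΦ x)) (div_nonneg
        (sq_nonneg ((1 + a) * t - ‖x‖ * ‖gradient u x‖)) hs.le)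
      have h4 : b * quadQuot M ‖gradient u x‖ *
          (((1 + a) * t - ‖x‖ * ‖gradient u x‖) ^ 2 / (1 + a)) =
          2 * (b / 2 * ((1 + a) * (quadQuot M ‖gradient u x‖ * t * t) +
          ‖x‖ ^ 2 * (quadQuot M ‖gradient u x‖ * ‖gradient u x‖ ^ 2) / (1 + a))) -
          2 * (‖x‖ * (b * t) * quadQuot M ‖gradient u x‖ * ‖gradient u x‖) := by
        field_simp
        ring
      linarith
    refine h2.trans ?_
    gcongr
    linarith
  have e6 := h.integral_gradient_le hu hc
  have hX : X ≤ 2 * n * A + c ^ 2 * (a ^ 2 * (A + 2 * H)) := by linarith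
  set S := A + U + H with hS
  have hn : (0 : ℝ) ≤ n := n.cast_nonneg
  have hX' : X / (1 + a) ≤ (2 * n + 2 * c ^ 2) * (1 + a) * S := by
    rw [div_le_iff₀ (by positivity)]
    have h1 : (2 : ℝ) * n * A ≤ 2 * n * ((1 + a) ^ 2 * S) := by
      gcongr
      nlinarith [mul_nonneg ha.le hA0, mul_nonneg (sq_nonneg a) hA0, mul_nonneg
        (sq_nonneg (1 + a)) (add_nonneg hU0 hH0)]
    have h2 : a ^ 2 * (A + 2 * H) ≤ (1 + a) ^ 2 * (2 * S) := by
      gcongr <;> linarith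
    nlinarith [mul_le_mul_of_nonneg_left h2 (sq_nonneg c)]
  calc A ≤ b / 2 * ((1 + a) * (2 * S) + (2 * n + 2 * c ^ 2) * (1 + a) * S) +
        c * ((1 + a) * b * S) := by
        have h1 : (1 + a) * (A + 2 * U) ≤ (1 + a) * (2 * S) := by
          gcongr
          linarith
        have h2 : a * b * S ≤ (1 + a) * b * S := by
          gcongr
          linarith
        have h3 := mul_le_mul_of_nonneg_left (add_le_add h1 hX') (half_pos hb).le
        have h4 := mul_le_mul_of_nonneg_left (e4.trans h2) hc0
        exact e6.trans (add_le_add (e5.trans h3) h4)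
    _ = _ := by ring

end Key

/-! ### Luxemburg norms of compactly supported functions -/

section Luxemburg

variable {n : ℕ} {M : ℝ → ℝ} {C : ℝ} {f : EuclideanSpace ℝ (Fin n) → ℝ}

lemma IsAdmissible.lintegral_le_one_iff (h : IsAdmissible M C) (hf : Continuous f)
    (hc : HasCompactSupport f) {K : ℝ} (hK : 0 < K) :
    ∫⁻ x, ENNReal.ofReal (M (|f x| / K)) ∂gaussMeasure n ≤ 1 ↔
      ∫ x, M (|f x| / K) ∂gaussMeasure n ≤ 1 := by
  have hi : Integrable (fun x => M (|f x| / K)) (gaussMeasure n) := by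
    simpa [abs_div, abs_of_pos hK] using h.integrable_comp_abs (f := fun x => f x / K)
      (by fun_prop) (hc.comp_left (g := fun r => r / K) (by simp))
  rw [← ofReal_integral_eq_lintegral_ofReal hi
    (ae_of_all _ fun x => h.nonneg_of_nonneg (by positivity)), ENNReal.ofReal_le_one]

/-- The choice `K = 1 + ∫ M(|f|)` is admissible, since `M(r/K) ≤ M(r)/K²` for `K ≥ 1`. -/
lemma IsAdmissible.memOrlicz (h : IsAdmissible M C) (hf : Continuous f)
    (hc : HasCompactSupport f) : MemOrlicz M (gaussMeasure n) f := by
  have hI : 0 ≤ ∫ x, M |f x| ∂gaussMeasure n :=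
    integral_nonneg fun x => h.nonneg_of_nonneg (abs_nonneg _)
  have hfi := h.integrable_comp_abs hf hc
  set I := ∫ x, M |f x| ∂gaussMeasure n
  have hK : 0 < 1 + I := by positivity
  refine ⟨hf.aemeasurable, 1 + I, hK, ?_⟩
  rw [h.lintegral_le_one_iff hf hc hK]
  have hle : ∀ x, M (|f x| / (1 + I)) ≤ M |f x| / (1 + I) ^ 2 := by
    intro x
    have h0 : 0 ≤ |f x| / (1 + I) := by positivity
    rw [← h.mul_sq_quadQuot h0, ← h.mul_sq_quadQuot (abs_nonneg (f x)), div_pow, mul_div_assoc]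
    gcongr
    exact h.monotone_quadQuot (div_le_self (abs_nonneg _) (by linarith))
  calc ∫ x, M (|f x| / (1 + I)) ∂gaussMeasure n
      ≤ ∫ x, M |f x| / (1 + I) ^ 2 ∂gaussMeasure n :=
        integral_mono_of_nonneg (ae_of_all _ fun x => h.nonneg_of_nonneg (by positivity))
          (hfi.div_const _) (ae_of_all _ hle)
    _ = I / (1 + I) ^ 2 := integral_div _ _
    _ ≤ 1 := by
        rw [div_le_one (by positivity)]
        nlinarith

lemma luxemburgNorm_nonneg {α : Type*} [MeasurableSpace α] (M : ℝ → ℝ) (μ : Measure α)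
    (f : α → ℝ) : 0 ≤ luxemburgNorm M μ f :=
  Real.sInf_nonneg fun _ hK => hK.1.le

lemma luxemburgNorm_le {α : Type*} [MeasurableSpace α] {M : ℝ → ℝ} {μ : Measure α}
    {f : α → ℝ} {K : ℝ} (hK : 0 < K) (h : ∫⁻ x, ENNReal.ofReal (M (|f x| / K)) ∂μ ≤ 1) :
    luxemburgNorm M μ f ≤ K :=
  csInf_le ⟨0, fun _ hK => hK.1.le⟩ ⟨hK, h⟩

/-- Every number larger than the Luxemburg norm is an admissible scaling factor. -/
lemma IsAdmissible.integral_le_one_of_luxemburgNorm_lt (h : IsAdmissible M C)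
    (hf : Continuous f) (hc : HasCompactSupport f) {K : ℝ}
    (hK : luxemburgNorm M (gaussMeasure n) f < K) :
    ∫ x, M (|f x| / K) ∂gaussMeasure n ≤ 1 := by
  obtain ⟨-, hne⟩ := h.memOrlicz hf hc
  obtain ⟨K', ⟨hK', hle⟩, hlt⟩ := exists_lt_of_csInf_lt hne hK
  rw [← h.lintegral_le_one_iff hf hc (hK'.trans hlt)]
  refine (lintegral_mono fun x => ENNReal.ofReal_le_ofReal (h.mono ?_ ?_)).trans hle
  · exact div_nonneg (abs_nonneg _) (hK'.trans hlt).le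
  · gcongr

end Luxemburg

/-! ### The modular and the norm inequality -/

section Interpolation

variable {n : ℕ} {M : ℝ → ℝ} {C : ℝ}

theorem IsAdmissible.exists_modular_inequality (h : IsAdmissible M C) (n : ℕ) :
    ∃ C₁ C₂ : ℝ, 0 < C₁ ∧ 0 < C₂ ∧
      ∀ u : EuclideanSpace ℝ (Fin n) → ℝ, ContDiff ℝ ∞ u → HasCompactSupport u →
        ∫ x, M ‖gradient u x‖ ∂gaussMeasure n ≤
          C₁ * ∫ x, M (hsNorm (hessian u x)) ∂gaussMeasure n +
          C₂ * ∫ x, M |u x| ∂gaussMeasure n := by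
  have hC := h.one_lt
  set c : ℝ := 1 + n + n * (C + 4) + (n * (C + 4)) ^ 2 with hc
  have hc0 : 0 < c := by positivity
  obtain ⟨D, hD, hdil⟩ := h.exists_dilation (k := 4 * c) (by positivity)
  refine ⟨1, D, one_pos, hD, fun u hu hus => ?_⟩
  -- With `a = 1` the factor `c b (1 + a)` equals `1 / 2`, so half of the left side is absorbed.
  have key := h.integral_gradient_le_scaled hu hus one_pos (b := 1 / (4 * c)) (by positivity)
  rw [← hc, show c * (1 / (4 * c) * (1 + 1)) = 1 / 2 by field_simp; norm_num] at key
  simp only [div_one] at key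
  have hU : ∫ x, M (|u x| / (1 / (4 * c))) ∂gaussMeasure n ≤
      D * ∫ x, M |u x| ∂gaussMeasure n := by
    rw [← integral_const_mul]
    refine integral_mono_of_nonneg (ae_of_all _ fun x => h.nonneg_of_nonneg (by positivity))
      ((h.integrable_comp_abs hu.continuous hus).const_mul D) (ae_of_all _ fun x => ?_)
    dsimp only
    rw [div_div_eq_mul_div, div_one, mul_comm]
    exact hdil _ (abs_nonneg _)
  linarith

/-- The scaled inequality for `u / K` with `K = L (√(ab) + b)`: for `L` large the modular of
`|∇u| / K` is at most one. -/
lemma IsAdmissible.luxemburgNorm_gradient_le (h : IsAdmissible M C)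
    {u : EuclideanSpace ℝ (Fin n) → ℝ} (hu : ContDiff ℝ ∞ u) (hus : HasCompactSupport u)
    {a b L : ℝ} (hL : L = 6 * (1 + n + n * (C + 4) + (n * (C + 4)) ^ 2) + 1)
    (ha : luxemburgNorm M (gaussMeasure n) (fun x => hsNorm (hessian u x)) < a)
    (hb : luxemburgNorm M (gaussMeasure n) u < b) :
    luxemburgNorm M (gaussMeasure n) (fun x => ‖gradient u x‖) ≤
      L * Real.sqrt (a * b) + L * b := by
  have hC := h.one_lt
  set c : ℝ := 1 + n + n * (C + 4) + (n * (C + 4)) ^ 2 with hc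
  have hc0 : 0 < c := by positivity
  have ha0 : 0 < a := (luxemburgNorm_nonneg _ _ _).trans_lt ha
  have hb0 : 0 < b := (luxemburgNorm_nonneg _ _ _).trans_lt hb
  have hL1 : 1 ≤ L := by rw [hL]; linarith
  have hL0 : 0 < L := by linarith
  have hU := h.integral_le_one_of_luxemburgNorm_lt hu.continuous hus hb
  have hH := h.integral_le_one_of_luxemburgNorm_lt (continuous_hsNorm_hessian hu)
    (hasCompactSupport_hsNorm_hessian hu hus) ha
  obtain ⟨K, hKdef⟩ : ∃ K, K = L * Real.sqrt (a * b) + L * b := ⟨_, rfl⟩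
  rw [← hKdef]
  have hs0 : 0 < Real.sqrt (a * b) := Real.sqrt_pos.2 (by positivity)
  have hss : Real.sqrt (a * b) ^ 2 = a * b := Real.sq_sqrt (by positivity)
  have hK : 0 < K := by rw [hKdef]; positivity
  refine luxemburgNorm_le hK ?_
  rw [h.lintegral_le_one_iff (contDiff_gradient hu).continuous.norm
    (hasCompactSupport_gradient hus).norm hK]
  have key := h.integral_gradient_le_scaled (u := K⁻¹ • u) (hu.const_smul K⁻¹)
    (hus.comp_left (g := fun r => K⁻¹ • r) (by simp)) (div_pos ha0 hK) (div_pos hb0 hK)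
  have e1 : ∀ x, ‖gradient (K⁻¹ • u) x‖ = |‖gradient u x‖| / K := fun x => by
    rw [gradient_const_smul _ hu, norm_smul, Real.norm_eq_abs, abs_of_pos (inv_pos.2 hK),
      abs_norm, inv_mul_eq_div]
  have e2 : ∀ x, |(K⁻¹ • u) x| / (b / K) = |u x| / b := fun x => by
    rw [Pi.smul_apply, smul_eq_mul, abs_mul, abs_of_pos (inv_pos.2 hK)]
    field_simp
  have e3 : ∀ x, hsNorm (hessian (K⁻¹ • u) x) / (a / K) = |hsNorm (hessian u x)| / a :=
    fun x => by
      rw [hessian_const_smul _ hu, hsNorm_smul, abs_of_pos (inv_pos.2 hK),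
        abs_of_nonneg (hsNorm_nonneg _)]
      field_simp
  simp only [e1, e2, e3] at key
  rw [← hc] at key
  have hA : 0 ≤ ∫ x, M (|‖gradient u x‖| / K) ∂gaussMeasure n :=
    integral_nonneg fun x => h.nonneg_of_nonneg (by positivity)
  have f1 : b / K ≤ 1 / L := by
    rw [div_le_div_iff₀ hK hL0, hKdef]
    nlinarith [mul_pos hL0 hs0]
  have f2 : b / K * (a / K) ≤ 1 / L := by
    have h1 : L * Real.sqrt (a * b) ≤ K := by rw [hKdef]; nlinarith [mul_pos hL0 hb0]
    have h2 : L ^ 2 * (a * b) ≤ K ^ 2 := by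
      rw [← hss, ← mul_pow]
      exact pow_le_pow_left₀ (by positivity) h1 2
    rw [div_mul_div_comm, div_le_div_iff₀ (by positivity) hL0]
    nlinarith [mul_pos ha0 hb0, mul_le_mul_of_nonneg_right hL1
      (mul_pos hL0 (mul_pos ha0 hb0)).le]
  have f3 : c * (b / K * (1 + a / K)) ≤ 1 / 3 := by
    have h1 : c * (b / K * (1 + a / K)) ≤ c * (2 / L) := by
      gcongr
      calc b / K * (1 + a / K) = b / K + b / K * (a / K) := by ring
        _ ≤ 1 / L + 1 / L := add_le_add f1 f2
        _ = 2 / L := by ring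
    refine h1.trans ?_
    rw [mul_div_assoc', div_le_div_iff₀ hL0 (by norm_num), hL]
    linarith
  have f4 : ∫ x, M (|‖gradient u x‖| / K) ∂gaussMeasure n ≤
      1 / 3 * (∫ x, M (|‖gradient u x‖| / K) ∂gaussMeasure n + 1 + 1) :=
    key.trans <| by
      gcongr
      have := integral_nonneg (μ := gaussMeasure n) (f := fun x => M (|u x| / b))
        fun x => h.nonneg_of_nonneg (by positivity)
      have := integral_nonneg (μ := gaussMeasure n)
        (f := fun x => M (|hsNorm (hessian u x)| / a))
        fun x => h.nonneg_of_nonneg (by positivity)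
      positivity
  linarith

theorem IsAdmissible.exists_norm_inequality (h : IsAdmissible M C) (n : ℕ) :
    ∃ L : ℝ, 0 < L ∧
      ∀ u : EuclideanSpace ℝ (Fin n) → ℝ, ContDiff ℝ ∞ u → HasCompactSupport u →
        luxemburgNorm M (gaussMeasure n) (fun x => ‖gradient u x‖) ≤
          L * Real.sqrt (luxemburgNorm M (gaussMeasure n) (fun x => hsNorm (hessian u x)) *
              luxemburgNorm M (gaussMeasure n) u) +
          L * luxemburgNorm M (gaussMeasure n) u := by
  have hC := h.one_lt
  refine ⟨6 * (1 + n + n * (C + 4) + (n * (C + 4)) ^ 2) + 1, by positivity,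
    fun u hu hus => ?_⟩
  set L : ℝ := 6 * (1 + n + n * (C + 4) + (n * (C + 4)) ^ 2) + 1 with hL
  set α := luxemburgNorm M (gaussMeasure n) (fun x => hsNorm (hessian u x)) with hα
  set β := luxemburgNorm M (gaussMeasure n) u with hβ
  have hcont : Continuous fun ε : ℝ => L * Real.sqrt ((α + ε) * (β + ε)) + L * (β + ε) := by
    fun_prop
  have hlim := (hcont.tendsto' 0 _ rfl).mono_left (nhdsWithin_le_nhds (s := Set.Ioi 0))
  simp only [add_zero] at hlim
  refine ge_of_tendsto hlim ?_
  filter_upwards [self_mem_nhdsWithin] with ε hε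
  have hε' : 0 < ε := hε
  exact h.luxemburgNorm_gradient_le hu hus hL (by linarith) (by linarith)

end Interpolation

end GaussLK

theorem corollary4p2 (n : ℕ) (hn : 1 ≤ n) (M : ℝ → ℝ)
    (hM : GaussLK.IsNFunction M)
    (hdiff : DifferentiableOn ℝ M (Set.Ici 0))
    (hΔ : GaussLK.DeltaTwo M)
    (hmono : MonotoneOn (fun r : ℝ => M r / r ^ 2) (Set.Ioi 0)) :
    (∃ C₁ C₂ : ℝ, 0 < C₁ ∧ 0 < C₂ ∧
      ∀ u : EuclideanSpace ℝ (Fin n) → ℝ, ContDiff ℝ ∞ u → HasCompactSupport u →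
        Integrable (fun x => M ‖gradient u x‖) (GaussLK.gaussMeasure n) ∧
        Integrable (fun x => M (GaussLK.hsNorm (GaussLK.hessian u x))) (GaussLK.gaussMeasure n) ∧
        Integrable (fun x => M |u x|) (GaussLK.gaussMeasure n) ∧
        ∫ x, M ‖gradient u x‖ ∂(GaussLK.gaussMeasure n) ≤
          C₁ * ∫ x, M (GaussLK.hsNorm (GaussLK.hessian u x)) ∂(GaussLK.gaussMeasure n) +
          C₂ * ∫ x, M |u x| ∂(GaussLK.gaussMeasure n)) ∧
    (∃ C₁ C₂ : ℝ, 0 < C₁ ∧ 0 < C₂ ∧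
      ∀ u : EuclideanSpace ℝ (Fin n) → ℝ, ContDiff ℝ ∞ u → HasCompactSupport u →
        GaussLK.MemOrlicz M (GaussLK.gaussMeasure n) (fun x => ‖gradient u x‖) ∧
        GaussLK.MemOrlicz M (GaussLK.gaussMeasure n)
          (fun x => GaussLK.hsNorm (GaussLK.hessian u x)) ∧
        GaussLK.MemOrlicz M (GaussLK.gaussMeasure n) u ∧
        GaussLK.luxemburgNorm M (GaussLK.gaussMeasure n) (fun x => ‖gradient u x‖) ≤
          C₁ * Real.sqrt
            (GaussLK.luxemburgNorm M (GaussLK.gaussMeasure n)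
                (fun x => GaussLK.hsNorm (GaussLK.hessian u x)) *
              GaussLK.luxemburgNorm M (GaussLK.gaussMeasure n) u) +
          C₂ * GaussLK.luxemburgNorm M (GaussLK.gaussMeasure n) u) := by
  obtain ⟨C, hC1, hC⟩ := hΔ
  have h : GaussLK.IsAdmissible M C := ⟨hM, hdiff, hC1, hC, hmono⟩
  constructor
  · obtain ⟨C₁, C₂, h₁, h₂, hle⟩ := h.exists_modular_inequality n
    exact ⟨C₁, C₂, h₁, h₂, fun u hu hc => ⟨h.integrable_comp_norm_gradient hu hc,
      h.integrable_comp_hsNorm_hessian hu hc, h.integrable_comp_abs hu.continuous hc,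
      hle u hu hc⟩⟩
  · obtain ⟨L, hL, hle⟩ := h.exists_norm_inequality n
    exact ⟨L, L, hL, hL, fun u hu hc =>
      ⟨h.memOrlicz (GaussLK.contDiff_gradient hu).continuous.norm
        (GaussLK.hasCompactSupport_gradient hc).norm,
      h.memOrlicz (GaussLK.continuous_hsNorm_hessian hu)
        (GaussLK.hasCompactSupport_hsNorm_hessian hu hc),
      h.memOrlicz hu.continuous hc, hle u hu hc⟩⟩
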